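/- Let $d\ge 0$ and let $\Delta\subset\mathbb{R}^d$ be a $d$-dimensional lattice simplex, i.e. the convex hull of affinely independent points $v_0,\dots,v_d\in\mathbb{Z}^d$. Its $\delta$-polynomial is $$\delta(\Delta,t)=(1-t)^{d+1}\Bigl(1+\sum_{n\ge 1}|n\Delta\cap\mathbb{Z}^d|\,t^n\Bigr),$$ and $\Lambda_\Delta$ is the subgroup of all $(\lambda_0,\dots,\lambda_d)\in(\mathbb{R}/\mathbb{Z})^{d+1}$ such that $\sum_{i=0}^d\lambda_i(v_i,1)\in\mathbb{Z}^{d+1}$. The simplex $\Delta$ is called a lattice pyramid if $d\ge1$ and there is a $(d-1)$-dimensional lattice simplex $\Gamma\subset\mathbb{R}^{d-1}$ such that $\Delta$ is mapped onto $\mathrm{conv}\bigl((\Gamma\times\{0\})\cup\{(0,\dots,0,1)\}\bigr)$ by a map $x\mapsto xU+w$ with $U\in\mathbb{Z}^{d\times d}$, $\det U=\pm1$, $w\in\mathbb{Z}^d$. **Theorem 3.4.** Let $p$ be a prime, let $k\ge 0$ be an integer, and let $\Delta\subset\mathbb{R}^d$ be a $d$-dimensional lattice simplex with $\delta(\Delta,t)=1+t^{k+1}+t^{2(k+1)}+\cdots+t^{(p^2-1)(k+1)}$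 which is not a lattice pyramid. Then one of the following holds: 1. $d=p^2(k+1)-1$; 2. $d=p^2(k+1)+(p-1)(k+1)-1$; 3. $d=p^2(k+1)+p(k+1)-1$. Moreover, in each case, up to a permutation of the $d+1$ coordinates, the group $\Lambda_\Delta$ is generated by the following vector(s): 1. $(1/p^2,\dots,1/p^2)\in(\mathbb{R}/\mathbb{Z})^{p^2(k+1)}$; 2. $\bigl(\underbrace{1/p,\dots,1/p}_{(p^2-1)(k+1)},\underbrace{1/p^2,\dots,1/p^2}_{p(k+1)}\bigr)\in(\mathbb{R}/\mathbb{Z})^{(p^2+p-1)(k+1)}$; 3. the two vectors $\bigl(\underbrace{1/p,\dots,1/p}_{p(k+1)},\underbrace{0,\dots,0}_{p^2(k+1)}\bigr)$ and $\bigl(\underbrace{0,\dots,0}_{p(k+1)},\underbrace{1/p,\dots,1/p}_{p^2(k+1)}\bigr)$ in $(\mathbb{R}/\mathbb{Z})^{p(p+1)(k+1)}$. -/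

import Mathlib

open scoped Pointwise

noncomputable section

/-- The inclusion of `ℤ ^ d` into `ℝ ^ d`. -/
def latticeVec {d : ℕ} (z : Fin d → ℤ) : Fin d → ℝ := fun j => (z j : ℝ)

/-- A `d`-dimensional lattice simplex in `ℝ ^ d`, given by its vertices `v_0, …, v_d`
(listed in some order), which are affinely independent points of `ℤ ^ d`. -/
structure LatticeSimplex (d : ℕ) where
  vertex : Fin (d + 1) → Fin d → ℤ
  affineIndependent : AffineIndependent ℝ fun i => latticeVec (vertex i)

/-- The simplex as a subset of `ℝ ^ d`: the convex hull of its vertices. -/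
def LatticeSimplex.toSet {d : ℕ} (Δ : LatticeSimplex d) : Set (Fin d → ℝ) :=
  convexHull ℝ (Set.range fun i => latticeVec (Δ.vertex i))

/-- The number `|P ∩ ℤ ^ d|` of lattice points of a (bounded) set `P`. -/
def latticePointCount {d : ℕ} (P : Set (Fin d → ℝ)) : ℕ :=
  {z : Fin d → ℤ | latticeVec z ∈ P}.ncard

/-- The Ehrhart series `1 + ∑_{n ≥ 1} |nP ∩ ℤ ^ d| t ^ n`. -/
def ehrhartSeries {d : ℕ} (P : Set (Fin d → ℝ)) : PowerSeries ℤ :=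
  PowerSeries.mk fun n => if n = 0 then 1 else (latticePointCount ((n : ℝ) • P) : ℤ)

/-- `f` is the `δ`-polynomial of the `d`-dimensional lattice simplex `Δ`:
`f(t) = (1 - t) ^ (d + 1) * (1 + ∑_{n ≥ 1} |nΔ ∩ ℤ ^ d| t ^ n)`. -/
def LatticeSimplex.IsDeltaPolynomial {d : ℕ} (Δ : LatticeSimplex d) (f : Polynomial ℤ) : Prop :=
  (f : PowerSeries ℤ) = (1 - PowerSeries.X) ^ (d + 1) * ehrhartSeries Δ.toSet

/-- Unimodular equivalence: `Q = f_U(P) + w` with `U` an integer matrix of determinant `± 1`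
acting on row vectors and `w` an integral vector. -/
def UnimodularlyEquivalent {d : ℕ} (P Q : Set (Fin d → ℝ)) : Prop :=
  ∃ (U : Matrix (Fin d) (Fin d) ℤ) (w : Fin d → ℤ), (U.det = 1 ∨ U.det = -1) ∧
    Q = (fun x => Matrix.vecMul x (U.map fun a : ℤ => (a : ℝ)) + latticeVec w) '' P

/-- The pyramid `conv(P × {0}, (0, …, 0, 1))` in `ℝ ^ (d + 1)`. -/
def pyr {d : ℕ} (P : Set (Fin d → ℝ)) : Set (Fin (d + 1) → ℝ) :=
  convexHull ℝ ((fun x => (Fin.snoc x 0 : Fin (d + 1) → ℝ)) '' P ∪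
    {(Fin.snoc (0 : Fin d → ℝ) 1 : Fin (d + 1) → ℝ)})

/-- `Δ` is, up to unimodular equivalence, the lattice pyramid over a lattice simplex of dimension
one less. (An iterated lattice pyramid over a simplex of smaller dimension is of this form.) -/
def LatticeSimplex.IsLatticePyramid : {d : ℕ} → LatticeSimplex d → Prop
  | 0, _ => False
  | e + 1, Δ => ∃ Γ : LatticeSimplex e, UnimodularlyEquivalent Δ.toSet (pyr Γ.toSet)

/-- The finite abelian group `Λ_Δ` of all `(λ_0, …, λ_d) ∈ (ℝ/ℤ) ^ (d + 1)` such that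
`∑ λ_i (v_i, 1)` lies in `ℤ ^ (d + 1)`, that is, vanishes in `(ℝ/ℤ) ^ (d + 1)`. -/
def LatticeSimplex.lambda {d : ℕ} (Δ : LatticeSimplex d) :
    AddSubgroup (Fin (d + 1) → UnitAddCircle) where
  carrier := {l | (∀ j, ∑ i, Δ.vertex i j • l i = 0) ∧ ∑ i, l i = 0}
  zero_mem' := by simp
  add_mem' := by
    rintro a b ⟨ha, ha'⟩ ⟨hb, hb'⟩
    exact ⟨fun j => by simp [smul_add, Finset.sum_add_distrib, ha, hb],
      by simp [Finset.sum_add_distrib, ha', hb']⟩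
  neg_mem' := by
    rintro a ⟨ha, ha'⟩
    exact ⟨fun j => by simp [ha], by simp [ha']⟩

/-- Membership in `Λ_Δ` through real representatives. -/
theorem LatticeSimplex.mk_mem_lambda_iff {d : ℕ} (Δ : LatticeSimplex d) (x : Fin (d + 1) → ℝ) :
    (fun i => (x i : UnitAddCircle)) ∈ Δ.lambda ↔
      (∀ j, ∃ m : ℤ, ∑ i, x i * (Δ.vertex i j : ℝ) = m) ∧ ∃ m : ℤ, ∑ i, x i = m := by
  have key : ∀ y : ℝ, (y : UnitAddCircle) = 0 ↔ ∃ m : ℤ, y = m := fun y => by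
    rw [AddCircle.coe_eq_zero_iff]
    simp [eq_comm]
  have hsum : ∀ y : Fin (d + 1) → ℝ,
      ∑ i, (y i : UnitAddCircle) = ((∑ i, y i : ℝ) : UnitAddCircle) := fun y =>
    (map_sum (QuotientAddGroup.mk' (AddSubgroup.zmultiples (1 : ℝ))) y Finset.univ).symm
  change (∀ j, ∑ i, Δ.vertex i j • (x i : UnitAddCircle) = 0) ∧
    ∑ i, (x i : UnitAddCircle) = 0 ↔ _
  simp only [← AddCircle.coe_zsmul, hsum, key, zsmul_eq_mul, mul_comm]

end

/-! A lattice point of `n • Δ` has unique barycentric coordinates; their fractional parts form an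
element of `Λ_Δ` and their floors a vector of naturals. Hence `δ(Δ, t) = ∑ t ^ height(λ)` over `λ ∈
Λ_Δ` (`ehrhartSeries_eq`, `IsDeltaPolynomial.eq_sum`). A coordinate vanishing on all of `Λ_Δ` would
make `Δ` a pyramid (`isLatticePyramid_of_forall_eq_zero`). What remains concerns a group of order `p
^ 2` with jointly injective, nonzero characters into `ℝ/ℤ` whose heights are `0, m, …, (p ^ 2 - 1)
m`, where `m = k + 1` (`classification_of_charHeight`).

Each character has kernel of order `1` or `p`. Pairing `g` with `-g` evaluates the total height and
gives `p * c` faithful characters and `(p + 1) * e` others, with `c + e = p * m`. Take `x` of height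
`m` and `y` of height `p * m`. A nonzero value is at least `1 / p ^ 2`, or `1 / p` when killed by
`p`. These bounds, summed at `x` and `y`, are attained, so every coordinate is determined; `c = 0`,
`e = 0` and the mixed case give the three families. -/

noncomputable section

/-- The representative in `[0, 1)` of a point of `ℝ / ℤ`. -/
def unitFract (x : UnitAddCircle) : ℝ := (AddCircle.equivIco (1 : ℝ) 0 x : ℝ)

theorem unitFract_nonneg (x : UnitAddCircle) : 0 ≤ unitFract x :=
  (AddCircle.equivIco (1 : ℝ) 0 x).2.1

theorem unitFract_lt_one (x : UnitAddCircle) : unitFract x < 1 := 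
  lt_of_lt_of_eq (AddCircle.equivIco (1 : ℝ) 0 x).2.2 (zero_add 1)

theorem coe_unitFract (x : UnitAddCircle) : ((unitFract x : ℝ) : UnitAddCircle) = x :=
  AddCircle.coe_equivIco

theorem unitFract_coe (y : ℝ) : unitFract (y : UnitAddCircle) = Int.fract y := 
  (AddCircle.coe_equivIco_mk_apply (1 : ℝ) y).trans (by simp)

theorem unitFract_coe_of_mem {y : ℝ} (h0 : 0 ≤ y) (h1 : y < 1) :
    unitFract (y : UnitAddCircle) = y := by
  rw [unitFract_coe, Int.fract_eq_self.2 ⟨h0, h1⟩]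

theorem unitFract_zero : unitFract 0 = 0 := by
  simpa using unitFract_coe_of_mem le_rfl zero_lt_one

theorem unitFract_eq_zero_iff {x : UnitAddCircle} : unitFract x = 0 ↔ x = 0 := by
  refine ⟨fun h => ?_, fun h => by rw [h, unitFract_zero]⟩
  rw [← coe_unitFract x, h, AddCircle.coe_zero]

/-! ### Lattice points of dilates and the height enumerator of `Λ_Δ`. -/

namespace LatticeSimplex

variable {d : ℕ} (Δ : LatticeSimplex d)

theorem mem_smul_toSet_iff (n : ℕ) (x : Fin d → ℝ) :
    x ∈ (n : ℝ) • Δ.toSet ↔ ∃ r : Fin (d + 1) → ℝ, (∀ i, 0 ≤ r i) ∧ ∑ i, r i = n ∧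
      ∀ j, ∑ i, r i * (Δ.vertex i j : ℝ) = x j := by
  have hconv : ∀ y : Fin d → ℝ, y ∈ Δ.toSet ↔ ∃ r : Fin (d + 1) → ℝ, (∀ i, 0 ≤ r i) ∧
      ∑ i, r i = 1 ∧ ∀ j, ∑ i, r i * (Δ.vertex i j : ℝ) = y j := by
    intro y
    have : Δ.toSet = (Fintype.linearCombination ℝ fun i => latticeVec (Δ.vertex i)) ''
        stdSimplex ℝ (Fin (d + 1)) := by
      rw [← convexHull_basis_eq_stdSimplex, LinearMap.image_convexHull, toSet, ← Set.range_comp]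
      congr 2
      ext i j
      simp [Fintype.linearCombination_apply, ite_apply]
    rw [this]
    constructor
    · rintro ⟨r, hr, rfl⟩
      refine ⟨r, hr.1, hr.2, fun j => ?_⟩
      simp [Fintype.linearCombination_apply, latticeVec]
    · rintro ⟨r, h0, h1, h⟩
      refine ⟨r, ⟨h0, h1⟩, ?_⟩
      ext j
      simp [Fintype.linearCombination_apply, latticeVec, h]
  rw [Set.mem_smul_set]
  constructor
  · rintro ⟨y, hy, rfl⟩
    obtain ⟨r, h0, h1, h⟩ := (hconv y).1 hy
    refine ⟨fun i => n * r i, fun i => mul_nonneg n.cast_nonneg (h0 i), ?_, fun j => ?_⟩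
    · rw [← Finset.mul_sum, h1, mul_one]
    · simp [mul_assoc, ← Finset.mul_sum, h]
  · rintro ⟨r, h0, h1, h⟩
    -- For `n = 0` rescaling is impossible, but all weights vanish and any point of `Δ` serves.
    rcases Nat.eq_zero_or_pos n with rfl | hn
    · have hr : ∀ i, r i = 0 := fun i =>
        (Finset.sum_eq_zero_iff_of_nonneg fun i _ => h0 i).1 (by simpa using h1) i
          (Finset.mem_univ i)
      refine ⟨latticeVec (Δ.vertex 0), subset_convexHull _ _ ⟨0, rfl⟩, ?_⟩
      ext j
      simp [← h, hr]
    · have hn' : (n : ℝ) ≠ 0 := by positivity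
      refine ⟨fun j => (n : ℝ)⁻¹ * x j, (hconv _).2
        ⟨fun i => (n : ℝ)⁻¹ * r i, fun i => mul_nonneg (by positivity) (h0 i), ?_, fun j => ?_⟩, ?_⟩
      · rw [← Finset.mul_sum, h1, inv_mul_cancel₀ hn']
      · simp [mul_assoc, ← Finset.mul_sum, h]
      · ext j
        simp [hn']

theorem eq_of_sum_eq {r s : Fin (d + 1) → ℝ} (h1 : ∑ i, r i = ∑ i, s i)
    (h : ∀ j, ∑ i, r i * (Δ.vertex i j : ℝ) = ∑ i, s i * (Δ.vertex i j : ℝ)) : r = s := by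
  have := affineIndependent_iff.1 Δ.affineIndependent Finset.univ (fun i => r i - s i)
    (by simp [h1]) (by
      ext j
      simp [latticeVec, sub_mul, h j])
  ext i
  linarith [this i (Finset.mem_univ i)]

theorem exists_sum_eq (t : ℝ) (x : Fin d → ℝ) : ∃ r : Fin (d + 1) → ℝ, ∑ i, r i = t ∧
    ∀ j, ∑ i, r i * (Δ.vertex i j : ℝ) = x j := by
  let f : (Fin (d + 1) → ℝ) →ₗ[ℝ] ℝ × (Fin d → ℝ) :=
    { toFun := fun r => (∑ i, r i, fun j => ∑ i, r i * (Δ.vertex i j : ℝ))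
      map_add' := fun r s => by
        ext <;> simp [add_mul, Finset.sum_add_distrib]
      map_smul' := fun c r => by
        ext <;> simp [mul_assoc, Finset.mul_sum] }
  have hf : Function.Injective f := fun r s h =>
    Δ.eq_of_sum_eq (congrArg Prod.fst h) fun j => congrFun (congrArg Prod.snd h) j
  have hs := (LinearMap.injective_iff_surjective_of_finrank_eq_finrank
    (by simp [add_comm])).1 hf
  obtain ⟨r, hr⟩ := hs (t, x)
  exact ⟨r, congrArg Prod.fst hr, fun j => congrFun (congrArg Prod.snd hr) j⟩

/-- The sum of the representatives in `[0, 1)` of the coordinates of an element of `Λ_Δ`. -/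
def height (l : Δ.lambda) : ℝ := ∑ i, unitFract (l.1 i)

theorem lambda_fract (l : Δ.lambda) :
    (∀ j, ∃ m : ℤ, ∑ i, unitFract (l.1 i) * (Δ.vertex i j : ℝ) = m) ∧
      ∃ m : ℤ, Δ.height l = m := by
  refine (Δ.mk_mem_lambda_iff fun i => unitFract (l.1 i)).1 ?_
  simp only [coe_unitFract]
  exact l.2

theorem exists_height (l : Δ.lambda) : ∃ n : ℕ, Δ.height l = n := by
  obtain ⟨m, hm⟩ := (Δ.lambda_fract l).2
  have : (0 : ℝ) ≤ m := hm ▸ Finset.sum_nonneg fun i _ => unitFract_nonneg _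
  refine ⟨m.toNat, ?_⟩
  rw [hm, ← Int.cast_natCast, Int.toNat_of_nonneg (by exact_mod_cast this)]

/-- The height of an element of `Λ_Δ`, as a natural number. -/
def heightNat (l : Δ.lambda) : ℕ := (Δ.exists_height l).choose

theorem height_eq (l : Δ.lambda) : Δ.height l = Δ.heightNat l := (Δ.exists_height l).choose_spec

/-- The lattice point with barycentric coordinates `λ + c`. -/
def point (l : Δ.lambda) (c : Fin (d + 1) →₀ ℕ) (j : Fin d) : ℤ :=
  ((Δ.lambda_fract l).1 j).choose + ∑ i, c i * Δ.vertex i j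

theorem point_cast (l : Δ.lambda) (c : Fin (d + 1) →₀ ℕ) (j : Fin d) :
    (Δ.point l c j : ℝ) = ∑ i, (unitFract (l.1 i) + c i) * (Δ.vertex i j : ℝ) := by
  simp only [point, add_mul, Finset.sum_add_distrib]
  push_cast
  rw [← ((Δ.lambda_fract l).1 j).choose_spec]

/-- Barycentric coordinates are unique, and each splits uniquely into a part in `[0, 1)` and a
natural number. -/
theorem point_injective {l l' : Δ.lambda} {c c' : Fin (d + 1) →₀ ℕ}
    (h1 : Δ.heightNat l + ∑ i, c i = Δ.heightNat l' + ∑ i, c' i)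
    (h : Δ.point l c = Δ.point l' c') : l = l' ∧ c = c' := by
  have key := Δ.eq_of_sum_eq (r := fun i => unitFract (l.1 i) + c i)
    (s := fun i => unitFract (l'.1 i) + c' i) (by
      simp only [Finset.sum_add_distrib]
      change Δ.height l + _ = Δ.height l' + _
      rw [height_eq, height_eq]
      exact_mod_cast h1) fun j => by rw [← point_cast, ← point_cast, h]
  have key' : ∀ i, c i = c' i := fun i => by
    have h : unitFract (l.1 i) + c i = unitFract (l'.1 i) + c' i := congrFun key i
    have h1 := unitFract_nonneg (l.1 i)
    have h2 := unitFract_lt_one (l.1 i)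
    have h3 := unitFract_nonneg (l'.1 i)
    have h4 := unitFract_lt_one (l'.1 i)
    have h5 : (c i : ℝ) < c' i + 1 := by linarith
    have h6 : (c' i : ℝ) < c i + 1 := by linarith
    norm_cast at h5 h6
    omega
  refine ⟨?_, Finsupp.ext key'⟩
  ext i
  rw [← coe_unitFract (l.1 i), ← coe_unitFract (l'.1 i)]
  have h : unitFract (l.1 i) + c i = unitFract (l'.1 i) + c' i := congrFun key i
  rw [key' i] at h
  rw [add_right_cancel h]

/-- Height and point with `c = 0` embed `Λ_Δ` into a bounded box of integer vectors; in `M`, the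
term `d + 1` bounds the height and the double sum bounds the point. -/
instance finite_lambda : Finite Δ.lambda := by
  let M : ℤ := d + 1 + ∑ i, ∑ j, |Δ.vertex i j|
  have hM : ∀ j, ∑ i, |Δ.vertex i j| ≤ M := fun j => by
    have h1 : ∑ i, |Δ.vertex i j| ≤ ∑ i, ∑ j, |Δ.vertex i j| :=
      Finset.sum_le_sum fun i _ => Finset.single_le_sum (f := fun j => |Δ.vertex i j|)
        (fun j _ => abs_nonneg _) (Finset.mem_univ j)
    simp only [M]
    linarith [(Nat.cast_nonneg d : (0 : ℤ) ≤ d)]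
  let F : Δ.lambda → ℤ × (Fin d → ℤ) := fun l => (Δ.heightNat l, Δ.point l 0)
  have hF : Function.Injective F := fun l l' h => by
    simp only [F, Prod.mk.injEq, Nat.cast_inj] at h
    exact (Δ.point_injective (by simp [h.1]) h.2).1
  have hr : ∀ l, F l ∈ Set.Icc ((-M, fun _ => -M) : ℤ × (Fin d → ℤ)) (M, fun _ => M) := by
    intro l
    have hp : ∀ j, |Δ.point l 0 j| ≤ M := fun j => by
      refine le_trans ?_ (hM j)
      have : |(Δ.point l 0 j : ℝ)| ≤ ∑ i, |(Δ.vertex i j : ℝ)| := by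
        rw [point_cast]
        refine (Finset.abs_sum_le_sum_abs _ _).trans (Finset.sum_le_sum fun i _ => ?_)
        rw [abs_mul]
        refine mul_le_of_le_one_left (abs_nonneg _) ?_
        simpa [abs_of_nonneg (unitFract_nonneg _)] using (unitFract_lt_one (l.1 i)).le
      exact_mod_cast this
    have hh : (Δ.heightNat l : ℤ) ≤ M := by
      have h1 : (Δ.heightNat l : ℝ) ≤ d + 1 := by
        rw [← height_eq]
        refine (Finset.sum_le_sum fun i _ => (unitFract_lt_one (l.1 i)).le).trans ?_
        simp
      have h2 : (0 : ℤ) ≤ ∑ i, ∑ j, |Δ.vertex i j| :=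
        Finset.sum_nonneg fun i _ => Finset.sum_nonneg fun j _ => abs_nonneg _
      have h3 : (Δ.heightNat l : ℤ) ≤ d + 1 := by exact_mod_cast h1
      simp only [M]
      linarith
    refine ⟨⟨?_, fun j => (abs_le.1 (hp j)).1⟩, hh, fun j => (abs_le.1 (hp j)).2⟩
    have : (0 : ℤ) ≤ Δ.heightNat l := Nat.cast_nonneg _
    change -M ≤ (Δ.heightNat l : ℤ)
    linarith
  classical
  have := (Set.finite_Icc ((-M, fun _ => -M) : ℤ × (Fin d → ℤ)) (M, fun _ => M)).to_subtype
  exact Finite.of_injective (Set.codRestrict F _ hr) (hF.codRestrict hr)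

instance fintype_lambda : Fintype Δ.lambda := Fintype.ofFinite _

theorem exists_point (n : ℕ) (z : Fin d → ℤ) (hz : latticeVec z ∈ (n : ℝ) • Δ.toSet) :
    ∃ l c, Δ.heightNat l + ∑ i, c i = n ∧ Δ.point l c = z := by
  obtain ⟨r, h0, h1, h⟩ := (Δ.mem_smul_toSet_iff n _).1 hz
  let l : Δ.lambda := ⟨fun i => (r i : UnitAddCircle),
    (Δ.mk_mem_lambda_iff r).2 ⟨fun j => ⟨z j, h j⟩, n, by simp [h1]⟩⟩
  let c : Fin (d + 1) →₀ ℕ := Finsupp.equivFunOnFinite.symm fun i => ⌊r i⌋₊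
  have hlc : ∀ i, unitFract (l.1 i) + c i = r i := fun i => by
    simp only [l, c, unitFract_coe, Finsupp.equivFunOnFinite_symm_apply_apply]
    rw [natCast_floor_eq_intCast_floor (h0 i), Int.fract_add_floor]
  refine ⟨l, c, ?_, ?_⟩
  · have : Δ.height l + ∑ i, (c i : ℝ) = n := by
      rw [← h1, height, ← Finset.sum_add_distrib, Finset.sum_congr rfl fun i _ => hlc i]
    rw [height_eq] at this
    exact_mod_cast this
  · ext j
    have : (Δ.point l c j : ℝ) = z j := by
      rw [point_cast, Finset.sum_congr rfl fun i _ => by rw [hlc i], h]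
      rfl
    exact_mod_cast this

/-- The points over a fixed `l` correspond to the ways of distributing the remaining `n - heightNat
l` among the `d + 1` vertices. -/
theorem latticePointCount_smul (n : ℕ) : latticePointCount ((n : ℝ) • Δ.toSet) =
    ∑ l : Δ.lambda, if Δ.heightNat l ≤ n then
      (Finset.finsuppAntidiag (Finset.univ : Finset (Fin (d + 1))) (n - Δ.heightNat l)).card
      else 0 := by
  classical
  let S : Finset (Σ _ : Δ.lambda, Fin (d + 1) →₀ ℕ) := Finset.univ.sigma fun l =>
    if Δ.heightNat l ≤ n then
      Finset.finsuppAntidiag (Finset.univ : Finset (Fin (d + 1))) (n - Δ.heightNat l) else ∅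
  have hS : ∀ a, a ∈ S ↔ Δ.heightNat a.1 + ∑ i, a.2 i = n := by
    rintro ⟨l, c⟩
    simp only [S, Finset.mem_sigma, Finset.mem_univ, true_and]
    split_ifs with h
    · simp only [Finset.mem_finsuppAntidiag, Finset.subset_univ, and_true]
      change ∑ i, c i = _ ↔ _
      omega
    · simp only [Finset.notMem_empty, false_iff]
      omega
  have hZ : {z : Fin d → ℤ | latticeVec z ∈ (n : ℝ) • Δ.toSet} =
      (S.image fun a => Δ.point a.1 a.2 : Finset _) := by
    ext z
    simp only [Set.mem_ofPred_eq, Finset.coe_image, Set.mem_image, Finset.mem_coe, hS]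
    constructor
    · intro hz
      obtain ⟨l, c, h, h'⟩ := Δ.exists_point n z hz
      exact ⟨⟨l, c⟩, h, h'⟩
    · rintro ⟨⟨l, c⟩, h, rfl⟩
      refine (Δ.mem_smul_toSet_iff n _).2 ⟨fun i => unitFract (l.1 i) + c i,
        fun i => add_nonneg (unitFract_nonneg _) (Nat.cast_nonneg _), ?_,
        fun j => (Δ.point_cast l c j).symm⟩
      rw [Finset.sum_add_distrib]
      change Δ.height l + _ = _
      rw [height_eq]
      exact_mod_cast h
  rw [latticePointCount, hZ, Set.ncard_coe_finset, Finset.card_image_of_injOn, Finset.card_sigma]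
  · refine Finset.sum_congr rfl fun l _ => ?_
    split_ifs <;> simp
  · rintro ⟨l, c⟩ h ⟨l', c'⟩ h' e
    obtain ⟨rfl, rfl⟩ := Δ.point_injective (((hS _).1 h).trans ((hS _).1 h').symm) e
    rfl

theorem ehrhartSeries_eq : ehrhartSeries Δ.toSet =
    (∑ l : Δ.lambda, PowerSeries.X ^ Δ.heightNat l) * (PowerSeries.mk 1) ^ (d + 1) := by
  have hc : ∀ n, PowerSeries.coeff n ((PowerSeries.mk 1 : PowerSeries ℤ) ^ (d + 1)) =
      (Finset.finsuppAntidiag (Finset.univ : Finset (Fin (d + 1))) n).card := fun n => by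
    have := PowerSeries.coeff_prod (fun _ : Fin (d + 1) => (PowerSeries.mk 1 : PowerSeries ℤ)) n
      Finset.univ
    simpa using this
  ext n
  rw [Finset.sum_mul, map_sum, ehrhartSeries, PowerSeries.coeff_mk]
  have h : (latticePointCount ((n : ℝ) • Δ.toSet) : ℤ) = ∑ l : Δ.lambda,
      PowerSeries.coeff n (PowerSeries.X ^ Δ.heightNat l * (PowerSeries.mk 1) ^ (d + 1)) := by
    rw [latticePointCount_smul]
    push_cast
    refine Finset.sum_congr rfl fun l _ => ?_
    rw [PowerSeries.coeff_X_pow_mul', hc]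
  rw [← h]
  split_ifs with hn
  · subst hn
    -- The constant term, set to `1` by definition, agrees with the count because `0 • Δ = {0}`.
    have : {z : Fin d → ℤ | latticeVec z ∈ ((0 : ℕ) : ℝ) • Δ.toSet} = {0} := by
      ext z
      rw [Nat.cast_zero, Set.zero_smul_set (s := Δ.toSet) ⟨_, subset_convexHull ℝ _ ⟨0, rfl⟩⟩]
      simp [funext_iff, latticeVec]
    rw [latticePointCount, this]
    simp
  · rfl

/-- The coefficients of the `δ`-polynomial count the elements of `Λ_Δ` of each height. -/
theorem IsDeltaPolynomial.eq_sum {Δ : LatticeSimplex d} {f : Polynomial ℤ}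
    (hf : Δ.IsDeltaPolynomial f) : f = ∑ l : Δ.lambda, Polynomial.X ^ Δ.heightNat l := by
  have h : (f : PowerSeries ℤ) = ∑ l : Δ.lambda, PowerSeries.X ^ Δ.heightNat l := by
    rw [hf, ehrhartSeries_eq, mul_left_comm, ← mul_pow, mul_comm (1 - PowerSeries.X),
      PowerSeries.mk_one_mul_one_sub_eq_one, one_pow, mul_one]
  ext n
  rw [← Polynomial.coeff_coe, h]
  simp [PowerSeries.coeff_X_pow, Polynomial.coeff_X_pow]

end LatticeSimplex

/-! ### Coordinates vanishing on `Λ_Δ` and lattice pyramids. -/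

/-- A surjective functional on `ℤ ^ (e + 1)` is the last coordinate of some basis. -/
theorem exists_basis_repr_last_eq {e : ℕ} (φ : (Fin (e + 1) → ℤ) →ₗ[ℤ] ℤ) (u : Fin (e + 1) → ℤ)
    (hu : φ u = 1) : ∃ B : Module.Basis (Fin (e + 1)) ℤ (Fin (e + 1) → ℤ),
      ∀ x, B.repr x (Fin.last e) = φ x := by
  obtain ⟨n, b⟩ := Submodule.basisOfPid (Pi.basisFun ℤ (Fin (e + 1))) (LinearMap.ker φ)
  -- Since `φ u = 1`, the lattice is `ℤ u ⊕ ker φ`, and `φ` reads off the coefficient of `u`.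
  let B₀ : Module.Basis (Fin (n + 1)) ℤ (Fin (e + 1) → ℤ) := Module.Basis.mkFinCons u b
    (fun c x hx h => by
      simpa only [map_add, map_smul, hu, LinearMap.mem_ker.1 hx, smul_eq_mul, mul_one, add_zero,
        map_zero] using congrArg φ h)
    (fun z => ⟨-φ z, by
      rw [LinearMap.mem_ker, map_add, map_smul, hu, smul_eq_mul, mul_one, add_neg_cancel]⟩)
  have hB₀ : ∀ x, B₀.repr x 0 = φ x := by
    have : B₀.coord 0 = φ := by
      refine B₀.ext fun i => ?_
      rw [Module.Basis.coord_apply, Module.Basis.repr_self]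
      refine Fin.cases ?_ (fun j => ?_) i
      · simp [B₀, Module.Basis.coe_mkFinCons, hu]
      · simp [B₀, Module.Basis.coe_mkFinCons]
    intro x
    rw [← this, Module.Basis.coord_apply]
  have hn : n + 1 = e + 1 := by
    simpa using (Module.finrank_eq_card_basis B₀).symm
  obtain rfl : n = e := by omega
  refine ⟨B₀.reindex Fin.revPerm, fun x => ?_⟩
  rw [Module.Basis.repr_reindex_apply, ← hB₀]
  simp

/-- The embedding of `ℝ ^ e` into `ℝ ^ (e + 1)` as a coordinate hyperplane. -/
def snocZero (e : ℕ) : (Fin e → ℝ) →ₗ[ℝ] (Fin (e + 1) → ℝ) where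
  toFun x := Fin.snoc x 0
  map_add' x y := by
    ext j
    refine Fin.lastCases ?_ (fun l => ?_) j <;> simp
  map_smul' c x := by
    ext j
    refine Fin.lastCases ?_ (fun l => ?_) j <;> simp

theorem pyr_convexHull {e : ℕ} {ι : Type*} (f : ι → Fin e → ℝ) :
    pyr (convexHull ℝ (Set.range f)) = convexHull ℝ
      (Set.range (fun j => (Fin.snoc (f j) 0 : Fin (e + 1) → ℝ)) ∪ {Fin.snoc 0 1}) := by
  change convexHull ℝ (snocZero e '' _ ∪ _) = _
  rw [LinearMap.image_convexHull, convexHull_convexHull_union_left, ← Set.range_comp]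
  rfl

namespace LatticeSimplex

/-- The barycentric coordinates of any integer point, with any integer total weight, define an
element of `Λ_Δ`. So the `i`-th one is always an integer, and it is an integral affine function. -/
theorem exists_functional {d : ℕ} (Δ : LatticeSimplex d) (i : Fin (d + 1))
    (h : ∀ l ∈ Δ.lambda, l i = 0) : ∃ (φ : (Fin d → ℤ) →ₗ[ℤ] ℤ) (b : ℤ),
      ∀ j, φ (Δ.vertex j) + b = if j = i then 1 else 0 := by
  have hint : ∀ (t : ℤ) (z : Fin d → ℤ), ∃ (r : Fin (d + 1) → ℝ) (m : ℤ), ∑ i, r i = t ∧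
      (∀ j, ∑ i, r i * (Δ.vertex i j : ℝ) = z j) ∧ r i = m := by
    intro t z
    obtain ⟨r, h1, h2⟩ := Δ.exists_sum_eq t (latticeVec z)
    have := h _ ((Δ.mk_mem_lambda_iff r).2 ⟨fun j => ⟨z j, h2 j⟩, t, h1⟩)
    rw [AddCircle.coe_eq_zero_iff] at this
    obtain ⟨m, hm⟩ := this
    exact ⟨r, m, h1, h2, by simpa using hm.symm⟩
  choose r m h1 h2 h3 using hint
  have hadd : ∀ t t' z z', m (t + t') (z + z') = m t z + m t' z' := fun t t' z z' => by
    have : r (t + t') (z + z') = r t z + r t' z' := Δ.eq_of_sum_eq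
      (by simp [Finset.sum_add_distrib, h1])
      fun j => by simp [Finset.sum_add_distrib, add_mul, h2]
    have := congrFun this i
    rw [Pi.add_apply, h3, h3, h3] at this
    exact_mod_cast this
  let φ : (Fin d → ℤ) →+ ℤ := AddMonoidHom.mk' (m 0) fun z z' => by simpa using hadd 0 0 z z'
  refine ⟨φ.toIntLinearMap, m 1 0, fun j => ?_⟩
  change m 0 (Δ.vertex j) + m 1 0 = _
  rw [← hadd, add_zero, zero_add]
  have : r 1 (Δ.vertex j) = Pi.single j 1 := Δ.eq_of_sum_eq (by simp [h1])
    fun l => by simp [h2, Pi.single_apply]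
  have := congrFun this i
  rw [h3, Pi.single_apply] at this
  simp only [eq_comm (a := j)]
  exact_mod_cast this

/-- Taking `φ` as last coordinate of a lattice basis puts the facet opposite `v_i` at height `0` and
`v_i` at height `1`. -/
theorem isLatticePyramid_of_forall_eq_zero {e : ℕ} (Δ : LatticeSimplex (e + 1))
    (i : Fin (e + 1 + 1)) (h : ∀ l ∈ Δ.lambda, l i = 0) : Δ.IsLatticePyramid := by
  obtain ⟨φ, b, hφ⟩ := Δ.exists_functional i h
  obtain ⟨B, hB⟩ := exists_basis_repr_last_eq φ (Δ.vertex i - Δ.vertex (i.succAbove 0)) (by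
    have h1 := hφ i
    have h2 := hφ (i.succAbove 0)
    rw [if_pos rfl] at h1
    rw [if_neg (Fin.succAbove_ne _ _)] at h2
    rw [map_sub]
    linarith)
  let U : Matrix (Fin (e + 1)) (Fin (e + 1)) ℤ := (LinearMap.toMatrix' B.equivFun.toLinearMap).transpose
  have hU : ∀ x, Matrix.vecMul x U = B.repr x := fun x => by
    rw [Matrix.vecMul_transpose, LinearMap.toMatrix'_mulVec]
    rfl
  have hdet : IsUnit U.det := by
    rw [Matrix.det_transpose, LinearMap.det_toMatrix']
    exact LinearEquiv.isUnit_det' _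
  -- The translation moves the apex above the origin and corrects its last coordinate by `b`.
  let w : Fin (e + 1) → ℤ := Fin.snoc (fun l => -B.repr (Δ.vertex i) l.castSucc) b
  let M : Matrix (Fin (e + 1)) (Fin (e + 1)) ℝ := U.map fun a : ℤ => (a : ℝ)
  have hM : IsUnit M := by
    rw [Matrix.isUnit_iff_isUnit_det]
    have : M.det = ((U.det : ℤ) : ℝ) := ((Int.castRingHom ℝ).map_det U).symm
    rw [this]
    exact hdet.map (Int.castRingHom ℝ)
  let G : (Fin (e + 1) → ℝ) →ᵃ[ℝ] (Fin (e + 1) → ℝ) :=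
    M.vecMulLinear.toAffineMap + AffineMap.const ℝ _ (latticeVec w)
  have hG : ∀ x, G x = Matrix.vecMul x M + latticeVec w := fun x => rfl
  have hGinj : Function.Injective G := fun x y hxy => by
    rw [hG, hG] at hxy
    exact Matrix.vecMul_injective_of_isUnit hM (add_right_cancel hxy)
  have hGz : ∀ z, G (latticeVec z) = latticeVec (⇑(B.repr z) + w) := fun z => by
    rw [hG, ← hU]
    ext l
    have := (Int.castRingHom ℝ).map_vecMul U z l
    simp only [Pi.add_apply, latticeVec, Int.cast_add]
    congr 1
    exact this.symm
  let g : Fin (e + 1) → Fin e → ℤ := fun j l =>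
    B.repr (Δ.vertex (i.succAbove j)) l.castSucc + w l.castSucc
  have hgi : G (latticeVec (Δ.vertex i)) = Fin.snoc 0 1 := by
    rw [hGz]
    ext l
    refine Fin.lastCases ?_ (fun l => ?_) l
    · have := hφ i
      rw [if_pos rfl] at this
      simp only [latticeVec, Pi.add_apply, hB, w, Fin.snoc_last, this, Int.cast_one]
    · simp [latticeVec, w]
  have hgj : ∀ j, G (latticeVec (Δ.vertex (i.succAbove j))) = Fin.snoc (latticeVec (g j)) 0 := by
    intro j
    rw [hGz]
    ext l
    refine Fin.lastCases ?_ (fun l => ?_) l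
    · have := hφ (i.succAbove j)
      rw [if_neg (Fin.succAbove_ne _ _)] at this
      simp only [latticeVec, Pi.add_apply, hB, w, Fin.snoc_last, this, Int.cast_zero]
    · simp [latticeVec, g]
  refine ⟨⟨g, AffineIndependent.of_comp (snocZero e).toAffineMap ?_⟩, U, w, Int.isUnit_iff.1 hdet, ?_⟩
  · have := (Δ.affineIndependent.map' G hGinj).comp_embedding i.succAboveEmb
    have h' : (G ∘ fun i => latticeVec (Δ.vertex i)) ∘ i.succAboveEmb =
        (snocZero e).toAffineMap ∘ fun i => latticeVec (g i) := funext hgj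
    rwa [h'] at this
  · change pyr (convexHull ℝ _) = G '' (convexHull ℝ _)
    rw [pyr_convexHull, AffineMap.image_convexHull, ← Set.range_comp]
    congr 1
    ext x
    simp only [Set.mem_union, Set.mem_range, Set.mem_singleton_iff, Function.comp_apply]
    constructor
    · rintro (⟨j, rfl⟩ | rfl)
      · exact ⟨i.succAbove j, hgj j⟩
      · exact ⟨i, hgi⟩
    · rintro ⟨j, rfl⟩
      rcases Fin.eq_self_or_eq_succAbove i j with rfl | ⟨j, rfl⟩
      · exact .inr hgi
      · exact .inl ⟨j, (hgj j).symm⟩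

end LatticeSimplex

/-! ### Estimates for representatives in `[0, 1)`. -/

theorem eq_coe_of_unitFract_eq {x : UnitAddCircle} {y : ℝ} (h : y = unitFract x) :
    x = (y : UnitAddCircle) := by
  rw [h, coe_unitFract]

theorem unitFract_pos {x : UnitAddCircle} (hx : x ≠ 0) : 0 < unitFract x :=
  (unitFract_nonneg x).lt_of_ne' fun h => hx (unitFract_eq_zero_iff.1 h)

theorem unitFract_add_unitFract_neg {x : UnitAddCircle} (hx : x ≠ 0) :
    unitFract x + unitFract (-x) = 1 := by
  have h : -x = ((1 - unitFract x : ℝ) : UnitAddCircle) := by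
    rw [AddCircle.coe_sub, AddCircle.coe_period, coe_unitFract, zero_sub]
  rw [h, unitFract_coe_of_mem (by linarith [unitFract_lt_one x]) (by linarith [unitFract_pos hx])]
  ring

/-- Here `n * unitFract x` is a positive integer. -/
theorem inv_le_unitFract {x : UnitAddCircle} {n : ℕ} (hn : 0 < n) (h : n • x = 0) (hx : x ≠ 0) :
    (1 / n : ℝ) ≤ unitFract x := by
  have hn' : (0 : ℝ) < n := Nat.cast_pos.2 hn
  have hpos := unitFract_pos hx
  rw [← coe_unitFract x, ← AddCircle.coe_nsmul, AddCircle.coe_eq_zero_iff] at h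
  obtain ⟨m, hm⟩ := h
  rw [zsmul_eq_mul, mul_one, nsmul_eq_mul] at hm
  have hm0 : (0 : ℝ) < m := hm ▸ mul_pos hn' hpos
  have hm1 : (1 : ℝ) ≤ m := by
    exact_mod_cast Int.add_one_le_iff.2 (Int.cast_pos.1 hm0)
  rw [div_le_iff₀ hn', mul_comm, ← hm]
  exact hm1

theorem unitFract_nsmul_le (n : ℕ) (x : UnitAddCircle) : unitFract (n • x) ≤ n * unitFract x := by
  conv_lhs => rw [← coe_unitFract x]
  rw [← AddCircle.coe_nsmul, unitFract_coe, nsmul_eq_mul]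
  have h : 0 ≤ (n : ℝ) * unitFract x := mul_nonneg n.cast_nonneg (unitFract_nonneg x)
  have : (0 : ℝ) ≤ ⌊(n : ℝ) * unitFract x⌋ := by exact_mod_cast Int.floor_nonneg.2 h
  linarith [Int.self_sub_floor ((n : ℝ) * unitFract x)]

/-! ### Heights of character families on a group of order `p ^ 2`. -/

section CharacterFamily

variable {G ι : Type*} [AddCommGroup G] [Fintype ι]

/-- The sum over a family of characters of the representatives in `[0, 1)` of the values. -/
def charHeight (χ : ι → G →+ UnitAddCircle) (g : G) : ℝ := ∑ i, unitFract (χ i g)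

variable {χ : ι → G →+ UnitAddCircle}

theorem charHeight_nsmul_le (n : ℕ) (g : G) : charHeight χ (n • g) ≤ n * charHeight χ g := by
  rw [charHeight, charHeight, Finset.mul_sum]
  exact Finset.sum_le_sum fun i _ => by
    rw [map_nsmul]
    exact unitFract_nsmul_le _ _

/-- The values at `g` and `-g` add up to `1` off the kernel and to `0` on it. -/
theorem two_mul_sum_unitFract [Fintype G] (f : G →+ UnitAddCircle) :
    2 * ∑ g, unitFract (f g) = Nat.card G - Nat.card f.ker := by
  classical
  have h1 : ∑ g, unitFract (f (-g)) = ∑ g, unitFract (f g) :=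
    Equiv.sum_comp (Equiv.neg G) fun g => unitFract (f g)
  have h2 : ∀ g, unitFract (f g) + unitFract (f (-g)) = 1 - if f g = 0 then 1 else 0 := by
    intro g
    split_ifs with h
    · rw [map_neg, h, neg_zero, unitFract_zero]
      norm_num
    · rw [map_neg, unitFract_add_unitFract_neg h, sub_zero]
  have h3 : Nat.card f.ker = (Finset.univ.filter fun g => f g = 0).card := by
    refine Nat.subtype_card _ fun g => ?_
    rw [Finset.mem_filter_univ, AddMonoidHom.mem_ker]
  rw [two_mul]
  nth_rewrite 2 [← h1]
  rw [← Finset.sum_add_distrib, Finset.sum_congr rfl fun g _ => h2 g, Finset.sum_sub_distrib, h3]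
  simp

theorem two_mul_sum_charHeight [Fintype G] : 2 * ∑ g, charHeight χ g =
    ∑ i, ((Nat.card G : ℝ) - Nat.card (χ i).ker) := by
  simp only [charHeight]
  rw [Finset.sum_comm, Finset.mul_sum]
  exact Finset.sum_congr rfl fun i _ => two_mul_sum_unitFract _

theorem sum_ite_const_mem (S : Finset ι) [DecidableEq ι] (a b : ℝ) :
    ∑ i, (if i ∈ S then a else b) = S.card * a + Sᶜ.card * b := by
  rw [← Finset.sum_add_sum_compl S, Finset.sum_congr rfl fun i hi => if_pos hi,
    Finset.sum_congr rfl fun i hi => if_neg (Finset.mem_compl.1 hi)]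
  simp

section PrimeSq

variable {p : ℕ}

theorem card_ker_eq_one_or_prime [Finite G] (hp : p.Prime) (hG : Nat.card G = p ^ 2) {f : G →+ UnitAddCircle}
    (hf : ∃ g, f g ≠ 0) : Nat.card f.ker = 1 ∨ Nat.card f.ker = p := by
  have h : Nat.card f.ker ∣ p ^ 2 := hG ▸ AddSubgroup.card_addSubgroup_dvd_card _
  obtain ⟨j, hj, h⟩ := (Nat.dvd_prime_pow hp).1 h
  interval_cases j
  · exact .inl (by simpa using h)
  · exact .inr (by simpa using h)
  · obtain ⟨g, hg⟩ := hf
    have := AddSubgroup.eq_top_of_card_eq f.ker (by rw [h, hG])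
    exact absurd (f.mem_ker.1 (this ▸ AddSubgroup.mem_top g)) hg

theorem nsmul_eq_zero_of_mem_addSubgroup {H : AddSubgroup G} (hH : Nat.card H = p) {g : G}
    (hg : g ∈ H) : p • g = 0 := by
  have : p • (⟨g, hg⟩ : H) = 0 := by
    rw [← hH]
    exact card_nsmul_eq_zero'
  exact congrArg Subtype.val this

theorem nsmul_apply_eq_zero_of_card_ker (hp : p.Prime) (hG : Nat.card G = p ^ 2)
    {f : G →+ UnitAddCircle} (hf : Nat.card f.ker = p) (g : G) : p • f g = 0 := by
  have h := f.ker.card_mul_index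
  rw [hf, hG, AddSubgroup.index_ker, sq] at h
  have := Nat.eq_of_mul_eq_mul_left hp.pos h
  have : p • (⟨f g, g, rfl⟩ : f.range) = 0 := by
    rw [← this]
    exact card_nsmul_eq_zero'
  exact congrArg Subtype.val this

theorem eq_top_of_mem_of_notMem_zmultiples [Finite G] (hp : p.Prime) (hG : Nat.card G = p ^ 2)
    {H : AddSubgroup G} {x y : G} (hx0 : x ≠ 0) (hpx : p • x = 0) (hx : x ∈ H) (hy : y ∈ H)
    (hxy : y ∉ AddSubgroup.zmultiples x) : H = ⊤ := by
  have := Fact.mk hp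
  have hord : addOrderOf x = p := addOrderOf_eq_prime hpx hx0
  have hle : AddSubgroup.zmultiples x ≤ H := AddSubgroup.zmultiples_le_of_mem hx
  have h : Nat.card H ∣ p ^ 2 := hG ▸ AddSubgroup.card_addSubgroup_dvd_card _
  obtain ⟨j, hj, h⟩ := (Nat.dvd_prime_pow hp).1 h
  have hz : Nat.card (AddSubgroup.zmultiples x) = p := by rw [Nat.card_zmultiples, hord]
  have hne : ¬ Nat.card H ≤ p := fun h' =>
    hxy ((AddSubgroup.eq_of_le_of_card_ge hle (by rwa [hz])) ▸ hy)
  have hj2 : j = 2 := by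
    interval_cases j
    · exact absurd (by rw [h, pow_zero]; exact hp.one_le) hne
    · exact absurd (by rw [h, pow_one]) hne
    · rfl
  exact AddSubgroup.eq_top_of_card_eq H (by rw [h, hG, hj2])

/-- As `f (p • g)` is the class of `1 / p`, which is nonzero, the order of `g` is neither `1` nor
`p`. -/
theorem zmultiples_eq_top_of_apply [Finite G] (hp : p.Prime) (hG : Nat.card G = p ^ 2)
    {f : G →+ UnitAddCircle} {g : G} (hg : f g = ((1 / (p : ℝ) ^ 2 : ℝ) : UnitAddCircle)) :
    AddSubgroup.zmultiples g = ⊤ := by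
  have hp0 : (0 : ℝ) < p := Nat.cast_pos.2 hp.pos
  have hp1 : (1 : ℝ) < p := Nat.one_lt_cast.2 hp.one_lt
  have hpg : p • g ≠ 0 := fun h => by
    have h1 : ((1 / (p : ℝ) : ℝ) : UnitAddCircle) = 0 := by
      have : p • f g = 0 := by rw [← map_nsmul, h, map_zero]
      rw [hg, ← AddCircle.coe_nsmul] at this
      rw [← this, nsmul_eq_mul]
      congr 1
      field_simp
    have h2 := unitFract_coe_of_mem (y := 1 / (p : ℝ)) (by positivity)
      ((div_lt_one hp0).2 hp1)
    rw [h1, unitFract_zero] at h2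
    have : 0 < 1 / (p : ℝ) := by positivity
    linarith
  have h : addOrderOf g ∣ p ^ 2 := hG ▸ addOrderOf_dvd_natCard g
  obtain ⟨j, hj, h⟩ := (Nat.dvd_prime_pow hp).1 h
  refine AddSubgroup.eq_top_of_card_eq _ ?_
  rw [Nat.card_zmultiples, hG, h]
  interval_cases j
  · rw [pow_zero, AddMonoid.addOrderOf_eq_one_iff] at h
    simp [h] at hpg
  · rw [pow_one] at h
    exact absurd (h ▸ addOrderOf_nsmul_eq_zero g) hpg
  · rfl

/-- Height is subadditive, so `n • x` with `n < p` has height at most `n * m < p * m`. -/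
theorem notMem_zmultiples_of_charHeight [Finite G] (hp : p.Prime) {m : ℕ} (hm : 0 < m) {x y : G}
    (hpx : p • x = 0) (hx : charHeight χ x = m) (hy : charHeight χ y = p * m) :
    y ∉ AddSubgroup.zmultiples x := by
  intro h
  classical
  obtain ⟨n, hn, rfl⟩ := Finset.mem_image.1 (mem_zmultiples_iff_mem_range_addOrderOf.1 h)
  replace hn : n < p := (Finset.mem_range.1 hn).trans_le (addOrderOf_le_of_nsmul_eq_zero hp.pos hpx)
  have h1 := charHeight_nsmul_le (χ := χ) n x
  rw [hx, hy] at h1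
  have : n * m < p * m := Nat.mul_lt_mul_of_pos_right hn hm
  have : (n : ℝ) * m < p * m := by exact_mod_cast this
  linarith

/-- The circle has only `p` points killed by `p`, so the `p`-torsion is no larger than the group
generated by `x`. -/
theorem mem_zmultiples_of_nsmul_eq_zero [Finite G] (hp : p.Prime) {f : G →+ UnitAddCircle}
    (hf : Function.Injective f) {x y : G} (hx0 : x ≠ 0) (hpx : p • x = 0) (hpy : p • y = 0) :
    y ∈ AddSubgroup.zmultiples x := by
  have := Fact.mk hp
  let K : AddSubgroup G := (nsmulAddMonoidHom p).ker
  have hK : ∀ g : K, ∃ n : Fin p, (((n : ℝ) / p * 1 : ℝ) : UnitAddCircle) = f g := fun g => by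
    have : p • f g = 0 := by
      rw [← map_nsmul, show p • (g : G) = 0 from g.2, map_zero]
    obtain ⟨n, hn, h⟩ := (AddCircle.nsmul_eq_zero_iff hp.pos).1 this
    exact ⟨⟨n, hn⟩, h⟩
  choose F hF using hK
  have hcard : Nat.card K ≤ p := by
    have := Nat.card_le_card_of_injective F fun a b hab =>
      Subtype.ext (hf (by rw [← hF, ← hF, hab]))
    simpa using this
  have hle : AddSubgroup.zmultiples x ≤ K := AddSubgroup.zmultiples_le_of_mem hpx
  rw [AddSubgroup.eq_of_le_of_card_ge hle
    (by rwa [Nat.card_zmultiples, addOrderOf_eq_prime hpx hx0])]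
  exact hpy


theorem classification_of_charHeight [DecidableEq ι] [Fintype G] (hp : p.Prime) (hG : Nat.card G = p ^ 2)
    {m : ℕ} (hm : 0 < m) (hinj : ∀ g, (∀ i, χ i g = 0) → g = 0) (hnz : ∀ i, ∃ g, χ i g ≠ 0)
    (hex : ∀ r < p ^ 2, ∃ g, charHeight χ g = r * m)
    (hle : ∀ g, charHeight χ g ≤ ((p : ℝ) ^ 2 - 1) * m)
    (hsum : 2 * ∑ g, charHeight χ g = (p : ℝ) ^ 2 * ((p : ℝ) ^ 2 - 1) * m) :
    (Fintype.card ι = p ^ 2 * m ∧ ∃ g, (∀ i, χ i g = ((1 / (p : ℝ) ^ 2 : ℝ) : UnitAddCircle)) ∧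
      AddSubgroup.zmultiples g = ⊤) ∨
    (∃ S : Finset ι, S.card = (p ^ 2 - 1) * m ∧ Sᶜ.card = p * m ∧ ∃ g,
      (∀ i ∈ S, χ i g = ((1 / (p : ℝ) : ℝ) : UnitAddCircle)) ∧
      (∀ i ∉ S, χ i g = ((1 / (p : ℝ) ^ 2 : ℝ) : UnitAddCircle)) ∧
      AddSubgroup.zmultiples g = ⊤) ∨
    (∃ S : Finset ι, S.card = p * m ∧ Sᶜ.card = p ^ 2 * m ∧ ∃ g g',
      (∀ i ∈ S, χ i g = ((1 / (p : ℝ) : ℝ) : UnitAddCircle) ∧ χ i g' = 0) ∧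
      (∀ i ∉ S, χ i g = 0 ∧ χ i g' = ((1 / (p : ℝ) : ℝ) : UnitAddCircle)) ∧
      AddSubgroup.closure {g, g'} = ⊤) := by
  classical
  have hp0 : (0 : ℝ) < p := Nat.cast_pos.2 hp.pos
  have hp1 : (1 : ℝ) < p := Nat.one_lt_cast.2 hp.one_lt
  have hm0 : (0 : ℝ) < m := Nat.cast_pos.2 hm
  have hlt : p < p ^ 2 := by nlinarith [hp.one_lt]
  let S₁ : Finset ι := Finset.univ.filter fun i => Nat.card (χ i).ker = 1
  have hS₁ : ∀ i ∈ S₁, Function.Injective (χ i) := fun i hi => by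
    rw [← AddMonoidHom.ker_eq_bot_iff]
    exact AddSubgroup.eq_bot_of_card_eq _ (Finset.mem_filter.1 hi).2
  have hS₁' : ∀ i ∈ S₁, ∀ g, g ≠ 0 → χ i g ≠ 0 := fun i hi g hg h =>
    hg (hS₁ i hi (h.trans (map_zero _).symm))
  have hS₂ : ∀ i ∉ S₁, Nat.card (χ i).ker = p := fun i hi =>
    (card_ker_eq_one_or_prime hp hG (hnz i)).resolve_left fun h =>
      hi (Finset.mem_filter.2 ⟨Finset.mem_univ _, h⟩)
  -- The double count of the total height determines the dimension up to one parameter.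
  obtain ⟨c, e, hc, he, hce⟩ : ∃ c e : ℕ, S₁.card = p * c ∧ S₁ᶜ.card = (p + 1) * e ∧
      c + e = p * m := by
    have h := two_mul_sum_charHeight (χ := χ)
    have h1 : ∀ i, ((Nat.card G : ℝ) - Nat.card (χ i).ker) =
        if i ∈ S₁ then (p : ℝ) ^ 2 - 1 else (p : ℝ) ^ 2 - p := fun i => by
      split_ifs with hi
      · rw [hG, (Finset.mem_filter.1 hi).2]
        simp
      · rw [hG, hS₂ i hi]
        simp
    rw [hsum, Finset.sum_congr rfl fun i _ => h1 i, sum_ite_const_mem] at h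
    have h2 : (p : ℝ) * (p * (p + 1) * m) = S₁.card * (p + 1) + S₁ᶜ.card * p := by
      have : (p : ℝ) - 1 ≠ 0 := by linarith
      apply mul_left_cancel₀ this
      linear_combination h
    have h3 : p * (p * (p + 1) * m) = S₁.card * (p + 1) + S₁ᶜ.card * p := by exact_mod_cast h2
    have h4 : p ∣ S₁.card * (p + 1) :=
      (Nat.dvd_add_left (dvd_mul_left p _)).1 (h3 ▸ dvd_mul_right p _)
    -- The divisibilities come from `p` and `p + 1` being coprime.
    obtain ⟨c, hc⟩ := Nat.Coprime.dvd_of_dvd_mul_right (by simp) h4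
    have h5 : p * (p + 1) * m = c * (p + 1) + S₁ᶜ.card := by
      apply Nat.eq_of_mul_eq_mul_left hp.pos
      rw [h3, hc]
      ring
    obtain ⟨e, he⟩ : p + 1 ∣ S₁ᶜ.card :=
      (Nat.dvd_add_right (dvd_mul_left (p + 1) c)).1
        (h5 ▸ ((dvd_mul_left (p + 1) p).mul_right m))
    refine ⟨c, e, hc, he, ?_⟩
    apply Nat.eq_of_mul_eq_mul_left p.succ_pos
    rw [he] at h5
    linarith
  have hceR : (c : ℝ) + e = p * m := by exact_mod_cast hce
  have hcR : (S₁.card : ℝ) = p * c := by exact_mod_cast hc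
  have heR : (S₁ᶜ.card : ℝ) = (p + 1) * e := by exact_mod_cast he
  obtain ⟨x, hx⟩ := hex 1 (by linarith [hp.one_lt])
  obtain ⟨y, hy⟩ := hex p hlt
  rw [Nat.cast_one, one_mul] at hx
  have hx0 : x ≠ 0 := by
    rintro rfl
    simp only [charHeight, map_zero, unitFract_zero, Finset.sum_const_zero] at hx
    linarith
  have hpsq : ∀ z : UnitAddCircle, ∀ i g, χ i g = z → p ^ 2 • z = 0 := by
    rintro _ i g rfl
    rw [← map_nsmul, ← hG, card_nsmul_eq_zero', map_zero]
  have hlow : ∀ i g, χ i g ≠ 0 → 1 / (p : ℝ) ^ 2 ≤ unitFract (χ i g) := fun i g h => by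
    have := inv_le_unitFract (pow_pos hp.pos 2) (hpsq _ i g rfl) h
    rwa [Nat.cast_pow] at this
  have hlow₂ : ∀ i ∉ S₁, ∀ g, χ i g ≠ 0 → 1 / (p : ℝ) ≤ unitFract (χ i g) := fun i hi g h =>
    inv_le_unitFract hp.pos (nsmul_apply_eq_zero_of_card_ker hp hG (hS₂ i hi) g) h
  rcases Nat.eq_zero_or_pos c with rfl | hc0
  · -- Every coordinate is killed by `p`.
    right; right
    have hS : ∀ i, i ∉ S₁ := by
      rw [mul_zero, Finset.card_eq_zero] at hc
      simp [hc]
    have hpx : p • x = 0 := hinj _ fun i => by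
      rw [map_nsmul]
      exact nsmul_apply_eq_zero_of_card_ker hp hG (hS₂ i (hS i)) x
    have hyx := notMem_zmultiples_of_charHeight (χ := χ) hp hm hpx hx hy
    let T : Finset ι := Finset.univ.filter fun i => χ i x ≠ 0
    have hT : ∀ i ∉ T, χ i x = 0 := fun i hi => by
      by_contra h
      exact hi (Finset.mem_filter.2 ⟨Finset.mem_univ _, h⟩)
    -- A kernel containing both `x` and `y` would be the whole group.
    have hTy : ∀ i ∉ T, χ i y ≠ 0 := fun i hi h => by
      obtain ⟨g, hg⟩ := hnz i
      have := eq_top_of_mem_of_notMem_zmultiples hp hG (H := (χ i).ker) hx0 hpx (hT i hi) h hyx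
      exact hg ((χ i).mem_ker.1 (this ▸ AddSubgroup.mem_top g))
    have hbx : ∀ i, (if i ∈ T then 1 / (p : ℝ) else 0) ≤ unitFract (χ i x) := fun i => by
      split_ifs with hi
      · exact hlow₂ i (hS i) x (Finset.mem_filter.1 hi).2
      · exact unitFract_nonneg _
    have hby : ∀ i, (if i ∈ T then 0 else 1 / (p : ℝ)) ≤ unitFract (χ i y) := fun i => by
      split_ifs with hi
      · exact unitFract_nonneg _
      · exact hlow₂ i (hS i) y (hTy i hi)
    have hsx := sum_ite_const_mem T (1 / (p : ℝ)) 0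
    have hsy := sum_ite_const_mem T 0 (1 / (p : ℝ))
    have hlx := (Finset.sum_le_sum fun i (_ : i ∈ Finset.univ) => hbx i).trans_eq hx
    have hly := (Finset.sum_le_sum fun i (_ : i ∈ Finset.univ) => hby i).trans_eq hy
    have hcard : (T.card : ℝ) + Tᶜ.card = p * m + p ^ 2 * m := by
      have h1 := Finset.card_add_card_compl T
      rw [← Finset.card_add_card_compl S₁, hc, he] at h1
      have h2 : T.card + Tᶜ.card = (p + 1) * (p * m) := by
        rw [h1, ← hce]
        ring
      have h3 : (T.card : ℝ) + Tᶜ.card = (p + 1) * (p * m) := by exact_mod_cast h2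
      rw [h3]
      ring
    rw [hsx, mul_zero, add_zero, mul_one_div, div_le_iff₀ hp0] at hlx
    rw [hsy, mul_zero, zero_add, mul_one_div, div_le_iff₀ hp0] at hly
    -- The two upper bounds add up to the exact total, so both are equalities.
    have hTR : (T.card : ℝ) = p * m := by linarith
    have hTR' : (Tᶜ.card : ℝ) = p ^ 2 * m := by linarith
    have hex := (Finset.sum_eq_sum_iff_of_le fun i (_ : i ∈ Finset.univ) => hbx i).1 (by
      rw [hsx, hTR]
      change _ = charHeight χ x
      rw [hx]
      field_simp
      ring)
    have hey := (Finset.sum_eq_sum_iff_of_le fun i (_ : i ∈ Finset.univ) => hby i).1 (by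
      rw [hsy, hTR']
      change _ = charHeight χ y
      rw [hy]
      field_simp
      ring)
    refine ⟨T, by exact_mod_cast hTR, by exact_mod_cast hTR', x, y, fun i hi => ?_, fun i hi => ?_,
      eq_top_of_mem_of_notMem_zmultiples hp hG hx0 hpx (AddSubgroup.subset_closure (by simp))
        (AddSubgroup.subset_closure (by simp)) hyx⟩
    · have h1 := hex i (Finset.mem_univ i)
      have h2 := hey i (Finset.mem_univ i)
      rw [if_pos hi] at h1 h2
      exact ⟨eq_coe_of_unitFract_eq h1, unitFract_eq_zero_iff.1 h2.symm⟩
    · have h1 := hex i (Finset.mem_univ i)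
      have h2 := hey i (Finset.mem_univ i)
      rw [if_neg hi] at h1 h2
      exact ⟨unitFract_eq_zero_iff.1 h1.symm, eq_coe_of_unitFract_eq h2⟩
  obtain ⟨i₀, hi₀⟩ : S₁.Nonempty := Finset.card_pos.1 (hc ▸ Nat.mul_pos hp.pos hc0)
  rcases Nat.eq_zero_or_pos e with rfl | he0
  · -- Every coordinate is faithful.
    left
    have hS : ∀ i, i ∈ S₁ := by
      rw [mul_zero, Finset.card_eq_zero, Finset.compl_eq_empty_iff] at he
      simp [he]
    have hcard : Fintype.card ι = p ^ 2 * m := by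
      rw [← Finset.card_add_card_compl S₁, he, hc, ← add_zero c, hce]
      ring
    have hex := (Finset.sum_eq_sum_iff_of_le fun i (_ : i ∈ Finset.univ) =>
      hlow i x (hS₁' i (hS i) x hx0)).1 (by
        change _ = charHeight χ x
        rw [hx, Finset.sum_const, Finset.card_univ, hcard, nsmul_eq_mul]
        push_cast
        field_simp)
    have hex' : ∀ i, χ i x = ((1 / (p : ℝ) ^ 2 : ℝ) : UnitAddCircle) := fun i =>
      eq_coe_of_unitFract_eq (hex i (Finset.mem_univ i))
    exact ⟨hcard, x, hex', zmultiples_eq_top_of_apply hp hG (hex' i₀)⟩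
  · right; left
    have he0R : (0 : ℝ) < e := Nat.cast_pos.2 he0
    have hpx : p • x = 0 := by
      -- Otherwise the heights of `x` and `-x` would sum to the number of coordinates, `p ^ 2 * m +
      -- e`, exceeding the permitted `m + (p ^ 2 - 1) * m`.
      obtain ⟨i, hi, hix⟩ : ∃ i, i ∉ S₁ ∧ χ i x = 0 := by
        by_contra! h
        have hne : ∀ i, χ i x ≠ 0 := fun i => by
          by_cases hi : i ∈ S₁
          · exact hS₁' i hi x hx0
          · exact h i hi
        have h1 : charHeight χ x + charHeight χ (-x) = S₁.card + S₁ᶜ.card := by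
          rw [charHeight, charHeight, ← Finset.sum_add_distrib]
          have : ∀ i, unitFract (χ i x) + unitFract (χ i (-x)) = 1 := fun i => by
            rw [map_neg, unitFract_add_unitFract_neg (hne i)]
          rw [Finset.sum_congr rfl fun i _ => this i, Finset.sum_const, Finset.card_univ,
            nsmul_eq_mul, mul_one, ← Finset.card_add_card_compl S₁, Nat.cast_add]
        have h2 := hle (-x)
        rw [hx, hcR, heR] at h1
        have h3 : (p : ℝ) * c + p * e = p ^ 2 * m := by
          rw [← mul_add, hceR]
          ring
        linarith
      exact nsmul_eq_zero_of_mem_addSubgroup (hS₂ i hi) hix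
    have hyx := notMem_zmultiples_of_charHeight (χ := χ) hp hm hpx hx hy
    have hcm : (c : ℝ) ≤ m := by
      have hb : ∀ i, (if i ∈ S₁ then 1 / (p : ℝ) else 0) ≤ unitFract (χ i x) := fun i => by
        split_ifs with hi
        · exact inv_le_unitFract hp.pos (by rw [← map_nsmul, hpx, map_zero]) (hS₁' i hi x hx0)
        · exact unitFract_nonneg _
      have h := (Finset.sum_le_sum fun i (_ : i ∈ Finset.univ) => hb i).trans_eq hx
      rwa [sum_ite_const_mem, hcR, mul_zero, add_zero, mul_one_div, mul_div_cancel_left₀ _ hp0.ne']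
        at h
    have hb : ∀ i, (if i ∈ S₁ then 1 / (p : ℝ) ^ 2 else 1 / (p : ℝ)) ≤ unitFract (χ i y) := by
      intro i
      split_ifs with hi
      · refine hlow i y (hS₁' i hi y ?_)
        rintro rfl
        exact hyx (zero_mem _)
      -- A faithful character exists, so the `p`-torsion is generated by `x`; an order-`p` kernel
      -- therefore cannot contain `y`.
      · exact hlow₂ i hi y fun h => hyx (mem_zmultiples_of_nsmul_eq_zero hp (hS₁ i₀ hi₀) hx0 hpx
          (nsmul_eq_zero_of_mem_addSubgroup (hS₂ i hi) h))
    have hs : ∑ i, (if i ∈ S₁ then 1 / (p : ℝ) ^ 2 else 1 / (p : ℝ)) = (c + (p + 1) * e) / p := by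
      rw [sum_ite_const_mem, hcR, heR]
      field_simp
    -- The bound at `y` reads `c + (p + 1) * e ≤ p * (c + e)`, that is `c + e ≤ p * c`.
    have hmc : (m : ℝ) ≤ c := by
      have h := (Finset.sum_le_sum fun i (_ : i ∈ Finset.univ) => hb i).trans_eq hy
      rw [hs, div_le_iff₀ hp0, ← hceR] at h
      have : (p : ℝ) * m ≤ p * c := by linarith
      exact le_of_mul_le_mul_left this hp0
    have hcmR : (c : ℝ) = m := le_antisymm hcm hmc
    obtain rfl : c = m := by exact_mod_cast hcmR
    have hey := (Finset.sum_eq_sum_iff_of_le fun i (_ : i ∈ Finset.univ) => hb i).1 (by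
      rw [hs]
      change _ = charHeight χ y
      rw [hy, div_eq_iff hp0.ne']
      linear_combination p * hceR + hceR)
    have hy₁ : ∀ i ∈ S₁, χ i y = ((1 / (p : ℝ) ^ 2 : ℝ) : UnitAddCircle) := fun i hi => by
      have := hey i (Finset.mem_univ i)
      rw [if_pos hi] at this
      exact eq_coe_of_unitFract_eq this
    refine ⟨S₁ᶜ, ?_, by rw [compl_compl, hc], y, fun i hi => ?_, fun i hi => ?_,
      zmultiples_eq_top_of_apply hp hG (hy₁ i₀ hi₀)⟩
    · obtain ⟨q, rfl⟩ : ∃ q, p = q + 1 := ⟨p - 1, (Nat.sub_add_cancel hp.one_le).symm⟩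
      have hq : e = q * c := by linarith
      have hq2 : (q + 1) ^ 2 - 1 = (q + 1 + 1) * q := by
        rw [Nat.sub_eq_iff_eq_add (Nat.succ_le_of_lt (by positivity : 0 < (q + 1) ^ 2))]
        ring
      rw [he, hq, hq2, mul_assoc]
    · have := hey i (Finset.mem_univ i)
      rw [if_neg (Finset.mem_compl.1 hi)] at this
      exact eq_coe_of_unitFract_eq this
    · exact hy₁ i (by simpa using hi)

end PrimeSq
end CharacterFamily

/-! ### From the `δ`-polynomial to the character family on `Λ_Δ`. -/

namespace LatticeSimplex

variable {d : ℕ} (Δ : LatticeSimplex d)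

/-- The coordinates on `Λ_Δ`. -/
def coord (i : Fin (d + 1)) : Δ.lambda →+ UnitAddCircle :=
  (Pi.evalAddMonoidHom (fun _ => UnitAddCircle) i).comp Δ.lambda.subtype

theorem coord_apply (i : Fin (d + 1)) (l : Δ.lambda) : Δ.coord i l = l.1 i := rfl

theorem charHeight_coord (l : Δ.lambda) : charHeight Δ.coord l = Δ.heightNat l :=
  Δ.height_eq l

theorem exists_coord_ne_zero (hcard : Nat.card Δ.lambda ≠ 1) (hpyr : ¬ Δ.IsLatticePyramid)
    (i : Fin (d + 1)) : ∃ l, Δ.coord i l ≠ 0 := by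
  by_contra! h
  -- In dimension `0` nothing is a pyramid by definition; there a vanishing coordinate makes `Λ_Δ`
  -- trivial, against `hcard`.
  rcases d with _ | e
  · have : Subsingleton Δ.lambda := ⟨fun a b => Subtype.ext <| funext fun j => by
      rw [Subsingleton.elim (α := Fin 1) j i, ← coord_apply, ← coord_apply, h, h]⟩
    exact hcard (Nat.card_eq_one_iff_unique.2 ⟨this, ⟨0⟩⟩)
  · exact hpyr (Δ.isLatticePyramid_of_forall_eq_zero i fun l hl => h ⟨l, hl⟩)

variable {Δ} {N m : ℕ}

theorem IsDeltaPolynomial.card_lambda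
    (hδ : Δ.IsDeltaPolynomial (∑ i ∈ Finset.range N, Polynomial.X ^ (i * m))) :
    Nat.card Δ.lambda = N := by
  have h := congrArg (Polynomial.eval 1) hδ.eq_sum
  simp only [Polynomial.eval_finsetSum, Polynomial.eval_pow, Polynomial.eval_X, one_pow,
    Finset.sum_const, Finset.card_range, nsmul_eq_mul, mul_one, Finset.card_univ] at h
  rw [Nat.card_eq_fintype_card]
  exact_mod_cast h.symm

/-- The derivative at `1` of the height enumerator is the total height. -/
theorem IsDeltaPolynomial.sum_heightNat
    (hδ : Δ.IsDeltaPolynomial (∑ i ∈ Finset.range N, Polynomial.X ^ (i * m))) :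
    ∑ l, Δ.heightNat l = ∑ i ∈ Finset.range N, i * m := by
  have h := congrArg (fun f => Polynomial.eval 1 (Polynomial.derivative f)) hδ.eq_sum
  simp only [Polynomial.derivative_sum, Polynomial.derivative_X_pow, Polynomial.eval_finsetSum,
    Polynomial.eval_mul, Polynomial.eval_C, Polynomial.eval_pow, Polynomial.eval_X, one_pow,
    mul_one] at h
  exact_mod_cast h.symm

theorem IsDeltaPolynomial.exists_heightNat_eq
    (hδ : Δ.IsDeltaPolynomial (∑ i ∈ Finset.range N, Polynomial.X ^ (i * m))) {r : ℕ}
    (hr : r < N) : ∃ l, Δ.heightNat l = r * m := by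
  by_contra! h
  have hc := congrArg (fun f => Polynomial.coeff f (r * m)) hδ.eq_sum
  simp only [Polynomial.finsetSum_coeff, Polynomial.coeff_X_pow] at hc
  rw [Finset.sum_eq_zero (s := Finset.univ) fun l _ => if_neg (h l).symm,
    Finset.sum_eq_zero_iff_of_nonneg fun i _ => by split_ifs <;> simp] at hc
  simpa using hc r (Finset.mem_range.2 hr)

theorem IsDeltaPolynomial.exists_lt_heightNat_eq
    (hδ : Δ.IsDeltaPolynomial (∑ i ∈ Finset.range N, Polynomial.X ^ (i * m))) (l : Δ.lambda) :
    ∃ r < N, Δ.heightNat l = r * m := by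
  by_contra! h
  have hc := congrArg (fun f => Polynomial.coeff f (Δ.heightNat l)) hδ.eq_sum
  simp only [Polynomial.finsetSum_coeff, Polynomial.coeff_X_pow] at hc
  rw [Finset.sum_eq_zero (s := Finset.range N) fun i hi => if_neg (h i (Finset.mem_range.1 hi)),
    eq_comm, Finset.sum_eq_zero_iff_of_nonneg fun i _ => by split_ifs <;> simp] at hc
  simpa using hc l (Finset.mem_univ l)

theorem lambda_eq_closure {s : Set Δ.lambda} (hs : AddSubgroup.closure s = ⊤) :
    Δ.lambda = AddSubgroup.closure (Subtype.val '' s) := by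
  have h := Δ.lambda.subtype.map_closure s
  rw [hs, ← AddMonoidHom.range_eq_map, AddSubgroup.range_subtype] at h
  exact h

end LatticeSimplex

/-! ### Permutation of the coordinates and conclusion. -/

theorem Finset.exists_equiv_sum {ι : Type*} [Fintype ι] [DecidableEq ι] (S : Finset ι) {a b : ℕ}
    (ha : S.card = a) (hb : Sᶜ.card = b) : ∃ σ : ι ≃ Fin a ⊕ Fin b,
      (∀ i ∈ S, ∃ j, σ i = .inl j) ∧ ∀ i ∉ S, ∃ j, σ i = .inr j := by
  let e₁ : {i // i ∈ S} ≃ Fin a := Fintype.equivFinOfCardEq (by simpa using ha)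
  let e₂ : {i // i ∉ S} ≃ Fin b := Fintype.equivFinOfCardEq (by
    rw [← hb]
    exact Fintype.card_of_subtype _ fun i => Finset.mem_compl)
  exact ⟨(Equiv.sumCompl (· ∈ S)).symm.trans (Equiv.sumCongr e₁ e₂),
    fun i hi => ⟨e₁ ⟨i, hi⟩, by simp [Equiv.sumCompl_symm_apply_of_pos, hi]⟩,
    fun i hi => ⟨e₂ ⟨i, hi⟩, by simp [Equiv.sumCompl_symm_apply_of_neg, hi]⟩⟩

theorem LatticeSimplex.IsDeltaPolynomial.lambda_classification {d : ℕ} {Δ : LatticeSimplex d}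
    {p m : ℕ} (hp : p.Prime) (hm : 0 < m)
    (hδ : Δ.IsDeltaPolynomial (∑ i ∈ Finset.range (p ^ 2), Polynomial.X ^ (i * m)))
    (hpyr : ¬ Δ.IsLatticePyramid) :
    (d + 1 = p ^ 2 * m ∧ ∃ σ : Fin (d + 1) ≃ Fin (p ^ 2 * m),
      Δ.lambda = AddSubgroup.closure
        {(fun _ => ((1 / (p : ℝ) ^ 2 : ℝ) : UnitAddCircle)) ∘ σ}) ∨
    (d + 1 = (p ^ 2 - 1) * m + p * m ∧ ∃ σ : Fin (d + 1) ≃ Fin ((p ^ 2 - 1) * m) ⊕ Fin (p * m),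
      Δ.lambda = AddSubgroup.closure
        {Sum.elim (fun _ => ((1 / (p : ℝ) : ℝ) : UnitAddCircle))
          (fun _ => ((1 / (p : ℝ) ^ 2 : ℝ) : UnitAddCircle)) ∘ σ}) ∨
    (d + 1 = p * m + p ^ 2 * m ∧ ∃ σ : Fin (d + 1) ≃ Fin (p * m) ⊕ Fin (p ^ 2 * m),
      Δ.lambda = AddSubgroup.closure
        {Sum.elim (fun _ => ((1 / (p : ℝ) : ℝ) : UnitAddCircle)) (fun _ => 0) ∘ σ,
          Sum.elim (fun _ => 0) (fun _ => ((1 / (p : ℝ) : ℝ) : UnitAddCircle)) ∘ σ}) := by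
  have hcard := hδ.card_lambda
  have hp2 : 1 < p ^ 2 := Nat.one_lt_pow two_ne_zero hp.one_lt
  have hsum : 2 * ∑ l, charHeight Δ.coord l = (p : ℝ) ^ 2 * ((p : ℝ) ^ 2 - 1) * m := by
    simp only [Δ.charHeight_coord]
    have h1 := hδ.sum_heightNat
    have h2 := Finset.sum_range_id_mul_two (p ^ 2)
    rw [← Finset.sum_mul] at h1
    have h3 : ((∑ i ∈ Finset.range (p ^ 2), i : ℕ) : ℝ) * 2 = (p : ℝ) ^ 2 * ((p : ℝ) ^ 2 - 1) := by
      have := congrArg (Nat.cast (R := ℝ)) h2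
      rwa [Nat.cast_mul, Nat.cast_mul, Nat.cast_sub hp2.le, Nat.cast_pow, Nat.cast_one,
        Nat.cast_ofNat] at this
    rw [← Nat.cast_sum, h1, Nat.cast_mul, ← h3]
    ring
  have hcompl : ∀ S : Finset (Fin (d + 1)), d + 1 = S.card + Sᶜ.card := fun S => by
    rw [Finset.card_add_card_compl, Fintype.card_fin]
  have key := classification_of_charHeight (χ := Δ.coord) hp hcard hm
    (fun l hl => Subtype.ext (funext hl))
    (Δ.exists_coord_ne_zero (by rw [hcard]; exact hp2.ne') hpyr)
    (fun r hr => by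
      obtain ⟨l, hl⟩ := hδ.exists_heightNat_eq hr
      exact ⟨l, by rw [Δ.charHeight_coord, hl, Nat.cast_mul]⟩)
    (fun l => by
      obtain ⟨r, hr, hl⟩ := hδ.exists_lt_heightNat_eq l
      rw [Δ.charHeight_coord, hl, Nat.cast_mul]
      refine mul_le_mul_of_nonneg_right ?_ m.cast_nonneg
      have : (r : ℝ) + 1 ≤ p ^ 2 := by exact_mod_cast hr
      linarith) hsum
  rcases key with ⟨hd, g, hg, htop⟩ | ⟨S, h1, h2, g, hg1, hg2, htop⟩ |
    ⟨S, h1, h2, g, g', hg1, hg2, htop⟩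
  · rw [Fintype.card_fin] at hd
    refine .inl ⟨hd, finCongr hd, ?_⟩
    refine (lambda_eq_closure ((AddSubgroup.zmultiples_eq_closure g).symm.trans htop)).trans ?_
    rw [Set.image_singleton]
    congr 2
    exact funext hg
  · obtain ⟨σ, hσ1, hσ2⟩ := S.exists_equiv_sum h1 h2
    refine .inr (.inl ⟨by rw [hcompl S, h1, h2], σ, ?_⟩)
    refine (lambda_eq_closure ((AddSubgroup.zmultiples_eq_closure g).symm.trans htop)).trans ?_
    rw [Set.image_singleton]
    congr 2
    ext i
    rw [Function.comp_apply, ← coord_apply]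
    by_cases hi : i ∈ S
    · obtain ⟨j, hj⟩ := hσ1 i hi
      rw [hj, hg1 i hi, Sum.elim_inl]
    · obtain ⟨j, hj⟩ := hσ2 i hi
      rw [hj, hg2 i hi, Sum.elim_inr]
  · obtain ⟨σ, hσ1, hσ2⟩ := S.exists_equiv_sum h1 h2
    refine .inr (.inr ⟨by rw [hcompl S, h1, h2], σ, ?_⟩)
    refine (lambda_eq_closure htop).trans ?_
    rw [Set.image_pair]
    congr 2
    · ext i
      rw [Function.comp_apply, ← coord_apply]
      by_cases hi : i ∈ S
      · obtain ⟨j, hj⟩ := hσ1 i hi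
        rw [hj, (hg1 i hi).1, Sum.elim_inl]
      · obtain ⟨j, hj⟩ := hσ2 i hi
        rw [hj, (hg2 i hi).1, Sum.elim_inr]
    · congr 1
      ext i
      rw [Function.comp_apply, ← coord_apply]
      by_cases hi : i ∈ S
      · obtain ⟨j, hj⟩ := hσ1 i hi
        rw [hj, (hg1 i hi).2, Sum.elim_inl]
      · obtain ⟨j, hj⟩ := hσ2 i hi
        rw [hj, (hg2 i hi).2, Sum.elim_inr]

end

theorem theorem3p4 (p : ℕ) (hp : p.Prime) (k d : ℕ) (Δ : LatticeSimplex d)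
    (hδ : Δ.IsDeltaPolynomial (∑ i ∈ Finset.range (p ^ 2), Polynomial.X ^ (i * (k + 1))))
    (hpyr : ¬ Δ.IsLatticePyramid) :
    (d = p ^ 2 * (k + 1) - 1 ∨
      d = p ^ 2 * (k + 1) + (p - 1) * (k + 1) - 1 ∨
      d = p ^ 2 * (k + 1) + p * (k + 1) - 1) ∧
    (d = p ^ 2 * (k + 1) - 1 →
      ∃ σ : Fin (d + 1) ≃ Fin (p ^ 2 * (k + 1)),
        Δ.lambda = AddSubgroup.closure
          {(fun _ => ((1 / (p : ℝ) ^ 2 : ℝ) : UnitAddCircle)) ∘ σ}) ∧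
    (d = p ^ 2 * (k + 1) + (p - 1) * (k + 1) - 1 →
      ∃ σ : Fin (d + 1) ≃ Fin ((p ^ 2 - 1) * (k + 1)) ⊕ Fin (p * (k + 1)),
        Δ.lambda = AddSubgroup.closure
          {Sum.elim (fun _ => ((1 / (p : ℝ) : ℝ) : UnitAddCircle))
            (fun _ => ((1 / (p : ℝ) ^ 2 : ℝ) : UnitAddCircle)) ∘ σ}) ∧
    (d = p ^ 2 * (k + 1) + p * (k + 1) - 1 →
      ∃ σ : Fin (d + 1) ≃ Fin (p * (k + 1)) ⊕ Fin (p ^ 2 * (k + 1)),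
        Δ.lambda = AddSubgroup.closure
          {Sum.elim (fun _ => ((1 / (p : ℝ) : ℝ) : UnitAddCircle)) (fun _ => 0) ∘ σ,
            Sum.elim (fun _ => 0) (fun _ => ((1 / (p : ℝ) : ℝ) : UnitAddCircle)) ∘ σ}) := by
  have hm : 0 < k + 1 := k.succ_pos
  have key := hδ.lambda_classification hp hm hpyr
  generalize k + 1 = m at *
  have h1 : (p - 1) * m + m = p * m := by
    rw [← Nat.succ_mul, Nat.succ_eq_add_one, Nat.sub_add_cancel hp.one_le]
  have h2 : (p ^ 2 - 1) * m + m = p ^ 2 * m := by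
    rw [← Nat.succ_mul, Nat.succ_eq_add_one, Nat.sub_add_cancel (Nat.one_le_pow _ _ hp.pos)]
  -- This makes `(p - 1) * m` positive, so the three dimensions are distinct and the dimension alone
  -- selects the case.
  have h3 : 2 * m ≤ p * m := Nat.mul_le_mul_right m hp.two_le
  rcases key with ⟨hd, h⟩ | ⟨hd, h⟩ | ⟨hd, h⟩
  · exact ⟨by omega, fun _ => h, fun _ => by omega, fun _ => by omega⟩
  · exact ⟨by omega, fun _ => by omega, fun _ => h, fun _ => by omega⟩
  · exact ⟨by omega, fun _ => by omega, fun _ => by omega, fun _ => h⟩
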